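/- For a finite simple graph $G=(V,E)$, a dimeric configuration is a set $D\subseteq E$ of pairwise vertex-disjoint edges. For $x>0$ the monomer-dimer model on $G$ is the probability measure $\mu_{G,x}(D)=Z_G(x)^{-1}x^{|V|-2|D|}$ on dimeric configurations, where $Z_G(x)=\sum_D x^{|V|-2|D|}$. For a vertex $o$, let $\mathcal R_x(G,o)$ be the $\mu_{G,x}$-probability that no edge of $D$ contains $o$ (a monomer on $o$). Let $P=(P_k)_{k\in\mathbb N}$ and $\rho=(\rho_k)_{k\in\mathbb N}$ be probability distributions on $\mathbb N=\{0,1,2,\dots\}$ with $\overline\rho:=\sum_k k\,\rho_k<\infty$. Let $\mathcal T(P,\rho)$ be a Galton-Watson tree with root $o$, defined on a probability space $(\Omega,\mathcal F,\mathbb P)$: the offspring numbers of all vertices are independent, that of the root has distribution $P$, and that of every other vertex has distribution $\rho$. Let $\mathcal T(P,\rho,r)$ be the (finite) sub-tree induced by its first $r$ generations, the root being generation $0$. Then: 1. Almost surely, for every $x>0$, the limit $Y(x):=\lim_{r\to\infty}\mathcal R_x(\mathcal T(P,\rho,r),o)$ exists. 2. Almost surely, the random function $x\mapsto Y(x)$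 is (real) analytic on $(0,\infty)$. 3. For every $x>0$ there is exactly one probability measure $\nu_x$ on $\mathbb R$ that is supported in $[0,1]$ and solves the fixed point distributional equation $$X\overset{\mathcal D}{=}\frac{x^2}{x^2+\sum_{i=1}^{K}X_i},$$ where $X$ has law $\nu_x$, $(X_i)_{i\ge1}$ are i.i.d. copies of $X$, and $K$ has distribution $\rho$ and is independent of $(X_i)_{i\ge 1}$. Moreover $$Y(x)\overset{\mathcal D}{=}\frac{x^2}{x^2+\sum_{i=1}^{\Delta}X_i},$$ where $(X_i)_{i\ge1}$ are i.i.d. with law $\nu_x$ and $\Delta$ has distribution $P$ and is independent of $(X_i)_{i\ge1}$. -/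

import Mathlib

open Set Filter Topology MeasureTheory ProbabilityTheory
open scoped ENNReal

noncomputable section

namespace MonomerDimer

/-! ### The monomer-dimer model on a finite simple graph -/

section Model

variable {V : Type*}

/-- A dimeric configuration: a family of edges of `G`, no two of which have a vertex in common. -/
def IsDimericConfig (G : SimpleGraph V) (D : Finset (Sym2 V)) : Prop :=
  (∀ e ∈ D, e ∈ G.edgeSet) ∧ ∀ e ∈ D, ∀ f ∈ D, ∀ v : V, v ∈ e → v ∈ f → e = f

/-- The monomeric configuration associated with `D`: the set of free vertices. -/
def monomers (D : Finset (Sym2 V)) : Set V := {v | ∀ u : V, s(u, v) ∉ D}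

variable [Fintype V]

open scoped Classical in
/-- The finite set of all dimeric configurations on `G`. -/
def dimericConfigs (G : SimpleGraph V) : Finset (Finset (Sym2 V)) :=
  Finset.univ.filter (IsDimericConfig G)

/-- The weight `x ^ (|V| - 2 |D|)` of a configuration. -/
def weight (V : Type*) [Fintype V] (x : ℝ) (D : Finset (Sym2 V)) : ℝ :=
  x ^ ((Fintype.card V : ℤ) - 2 * (D.card : ℤ))

/-- The partition function `Z_G(x)`. -/
def partitionFunction (G : SimpleGraph V) (x : ℝ) : ℝ :=
  ∑ D ∈ dimericConfigs G, weight V x D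

/-- The probability `μ_{G,x}(D)` of a dimeric configuration. -/
def gibbs (G : SimpleGraph V) (x : ℝ) (D : Finset (Sym2 V)) : ℝ :=
  (partitionFunction G x)⁻¹ * weight V x D

/-- The expected value of `f` with respect to `μ_{G,x}`. -/
def bracket (G : SimpleGraph V) (x : ℝ) (f : Finset (Sym2 V) → ℝ) : ℝ :=
  ∑ D ∈ dimericConfigs G, f D * gibbs G x D

/-- `R_x(G, o)`: the probability of having a monomer on the vertex `o`. -/
def monomerProb (x : ℝ) (G : SimpleGraph V) (o : V) : ℝ :=
  bracket G x (fun D => {D | o ∈ monomers D}.indicator (fun _ => (1 : ℝ)) D)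

end Model

/-! ### Galton-Watson trees

Vertices are labelled by words: the root is `[]`, and the sons of the vertex `v` are
`v ++ [0], …, v ++ [k v - 1]`, where `k v` is the offspring number of `v`.  The generation of a
vertex is the length of its word. -/

section Tree

/-- The vertex set of the tree with offspring numbers `k`. -/
def vertexSet (k : List ℕ → ℕ) : Set (List ℕ) :=
  {v | ∀ (u : List ℕ) (i : ℕ), u ++ [i] <+: v → i < k u}

/-- The tree with offspring numbers `k`: every vertex is connected to its sons. -/
def tree (k : List ℕ → ℕ) : SimpleGraph (vertexSet k) where
  Adj v w := ∃ i : ℕ, w.1 = v.1 ++ [i] ∨ v.1 = w.1 ++ [i]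
  symm := ⟨fun _ _ ⟨i, h⟩ => ⟨i, h.symm⟩⟩
  loopless := ⟨fun v ⟨i, h⟩ => by
    rcases h with h | h <;> simpa using congrArg List.length h⟩

/-- The vertices in the first `r` generations (the root being generation `0`). -/
def firstGenerations (k : List ℕ → ℕ) (r : ℕ) : Set (vertexSet k) :=
  {v | v.1.length ≤ r}

/-- The sub-tree induced by the first `r` generations. -/
def truncatedTree (k : List ℕ → ℕ) (r : ℕ) : SimpleGraph (firstGenerations k r) :=
  (tree k).induce (firstGenerations k r)

/-- The root, as a vertex of the truncated tree. -/
def root (k : List ℕ → ℕ) (r : ℕ) : firstGenerations k r :=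
  ⟨⟨[], fun u i h => by simp at h⟩, Nat.zero_le r⟩

theorem finite_words (k : List ℕ → ℕ) (r : ℕ) :
    {v : List ℕ | v ∈ vertexSet k ∧ v.length ≤ r}.Finite := by
  induction r with
  | zero =>
    refine (Set.finite_singleton ([] : List ℕ)).subset ?_
    rintro v ⟨-, hv⟩
    simpa using hv
  | succ r ih =>
    refine ((Set.finite_singleton ([] : List ℕ)).union
      (ih.biUnion fun v _ => (Set.finite_Iio (k v)).image fun i => v ++ [i])).subset ?_
    rintro v ⟨hv, hl⟩
    rcases List.eq_nil_or_concat v with rfl | ⟨u, i, rfl⟩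
    · exact Or.inl rfl
    · refine Or.inr (Set.mem_biUnion (x := u) ⟨?_, ?_⟩ ⟨i, hv u i (by simp), by simp⟩)
      · exact fun w j h => hv w j (h.trans (by simp))
      · simpa using hl

instance (k : List ℕ → ℕ) (r : ℕ) : Finite (firstGenerations k r) := by
  have := (finite_words k r).to_subtype
  exact Finite.of_injective
    (fun v : firstGenerations k r =>
      (⟨v.1.1, v.1.2, v.2⟩ : {v : List ℕ | v ∈ vertexSet k ∧ v.length ≤ r}))
    fun v w h => Subtype.ext (Subtype.ext (Subtype.mk.inj h))

instance (k : List ℕ → ℕ) (r : ℕ) : Fintype (firstGenerations k r) := Fintype.ofFinite _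

/-- The family `K` of random offspring numbers generates a Galton-Watson tree `T(P, ρ)`: the root
has offspring distribution `P`, every other vertex has offspring distribution `ρ`, and all the
offspring numbers are independent. -/
structure IsGaltonWatson {Ω : Type*} [MeasurableSpace Ω] (P ρ : PMF ℕ) (μ : Measure Ω)
    (K : List ℕ → Ω → ℕ) : Prop where
  measurable : ∀ v, Measurable (K v)
  law_root : μ.map (K []) = P.toMeasure
  law_of_ne_root : ∀ v, v ≠ [] → μ.map (K v) = ρ.toMeasure
  indep : iIndepFun K μ

end Tree

/-! ### The distributional recursion -/

section Recursion

/-- The map `(n, (X_i)_i) ↦ x² / (x² + ∑_{i < n} X_i)`. -/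
def recursionMap (x : ℝ) (p : ℕ × (ℕ → ℝ)) : ℝ :=
  x ^ 2 / (x ^ 2 + ∑ i ∈ Finset.range p.1, p.2 i)

theorem measurable_recursionMap (x : ℝ) : Measurable (recursionMap x) := by
  refine measurable_from_prod_countable_right fun n => ?_
  have h : Measurable fun y : ℕ → ℝ => ∑ i ∈ Finset.range n, y i :=
    Finset.measurable_fun_sum _ fun i _ => measurable_pi_apply i
  exact measurable_const.div (measurable_const.add h)

/-- The law of `x² / (x² + ∑_{i < N} X_i)`, where `N` has distribution `Q`, the `X_i` are i.i.d.
with law `ν`, and `N` is independent of `(X_i)_i`. -/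
def recursionLaw (Q : PMF ℕ) (x : ℝ) (ν : ProbabilityMeasure ℝ) : ProbabilityMeasure ℝ :=
  ⟨(Q.toMeasure.prod (Measure.infinitePi fun _ : ℕ => (ν : Measure ℝ))).map (recursionMap x),
    Measure.isProbabilityMeasure_map (measurable_recursionMap x).aemeasurable⟩

/-- `ν` is supported in `[0, 1]` and solves the fixed point equation
`X = x² / (x² + ∑_{i < N} X_i)` in distribution, where `N` has distribution `Q`. -/
def IsFixedPointLaw (Q : PMF ℕ) (x : ℝ) (ν : ProbabilityMeasure ℝ) : Prop :=
  (∀ᵐ y ∂(ν : Measure ℝ), y ∈ Icc (0 : ℝ) 1) ∧ recursionLaw Q x ν = ν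

end Recursion

end MonomerDimer

end

/-! Deleting a vertex `o` of a tree separates the subtrees of its sons, so expanding the partition
function at `o` gives a recursion: the root probability is x² / (x² + the sum of the root
probabilities of the sons' subtrees), started from 1 in the last generation
(`monomerProb_truncatedTree`).

Convergence. The recursion has Lipschitz constant x⁻² in each son's value. On a tree with offspring
law ρ everywhere, the expected distance between successive truncations therefore shrinks by the
factor ρ̄/x², and for x² > ρ̄ the sequence is almost surely Cauchy (`ae_exists_tendsto_of_large`).
For the other x, the recursion divided by x extends holomorphically to the half-plane Re z > 0, with
the bound 1/Re z uniform in the depth. By Vitali's theorem (`exists_analytic_limit`), convergence at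
countably many large activities with a limit point spreads to the whole half-plane; this gives one
null set for all x, and analyticity of the limit. A root with offspring law P, whose mean may be
infinite, costs one more step of the recursion, applied to the limits at its sons.

Fixed point. The subtrees at the sons are i.i.d. and independent of the number of sons
(`map_root_subtrees`), so the limit on a ρ-tree has a fixed point law and the limit on the P-tree is
its image under one recursion step. For uniqueness, the recursion is started in generation r from
i.i.d. values with a given fixed point law, which it preserves (`map_treeRec`). Since the recursion
is antitone, these values in [0, 1] squeeze the result between two successive truncations
(`treeRec_between`); it tends to the same limit, so the given law is the law of that limit. -/

noncomputable section

namespace MonomerDimer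

/-! ### Partition functions of induced subgraphs and their expansion at a vertex -/

section Matchings

variable {V : Type*} [Fintype V] {G : SimpleGraph V} {x : ℝ}

open scoped Classical in
/-- The dimeric configurations on `G` whose edges lie inside `S`. -/
def configsIn (G : SimpleGraph V) (S : Finset V) : Finset (Finset (Sym2 V)) :=
  (dimericConfigs G).filter fun D => ∀ e ∈ D, ∀ v ∈ e, v ∈ S

/-- The partition function of the subgraph of `G` induced by `S`. -/
def partitionIn (G : SimpleGraph V) (x : ℝ) (S : Finset V) : ℝ :=
  ∑ D ∈ configsIn G S, x ^ ((S.card : ℤ) - 2 * (D.card : ℤ))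

theorem mem_dimericConfigs {D : Finset (Sym2 V)} :
    D ∈ dimericConfigs G ↔ IsDimericConfig G D := by
  simp [dimericConfigs]

theorem mem_configsIn {S : Finset V} {D : Finset (Sym2 V)} :
    D ∈ configsIn G S ↔ IsDimericConfig G D ∧ ∀ e ∈ D, ∀ v ∈ e, v ∈ S := by
  simp [configsIn, mem_dimericConfigs]

theorem partitionIn_pos (hx : 0 < x) (S : Finset V) : 0 < partitionIn G x S := by
  refine Finset.sum_pos (fun D _ => zpow_pos hx _) ⟨∅, ?_⟩
  simp [mem_configsIn, IsDimericConfig]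

theorem partitionIn_univ : partitionIn G x Finset.univ = partitionFunction G x := by
  have : configsIn G Finset.univ = dimericConfigs G := by
    ext D; simp [mem_configsIn, mem_dimericConfigs]
  simp [partitionIn, partitionFunction, weight, this]

theorem partitionIn_empty : partitionIn G x ∅ = 1 := by
  have : configsIn G ∅ = {∅} := by
    ext D
    rw [mem_configsIn, Finset.mem_singleton]
    constructor
    · rintro ⟨-, h⟩
      refine Finset.eq_empty_of_forall_notMem fun e he => ?_
      induction e with
      | h a b => simpa using h _ he a (by simp)
    · rintro rfl
      simp [IsDimericConfig]
  simp [partitionIn, this]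

variable [DecidableEq V]

/-- With `erase_edge_mem_configsIn`, one half of the bijection behind the expansion at `o`: a
configuration that matches `o` with `u` amounts to one avoiding both vertices. -/
theorem insert_edge_mem_configsIn {S : Finset V} {o u : V} (ho : o ∉ S) (hu : u ∈ S)
    (hou : G.Adj o u) {D : Finset (Sym2 V)} (hD : D ∈ configsIn G (S.erase u)) :
    insert s(o, u) D ∈ configsIn G (insert o S) ∧ s(o, u) ∉ D := by
  rw [mem_configsIn] at hD
  obtain ⟨⟨h1, h2⟩, h3⟩ := hD
  have hno : ∀ e ∈ D, ∀ v ∈ e, v ≠ o ∧ v ≠ u ∧ v ∈ S := fun e he v hv => by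
    have := Finset.mem_erase.1 (h3 e he v hv)
    exact ⟨fun h => ho (h ▸ this.2), this.1, this.2⟩
  refine ⟨mem_configsIn.2 ⟨⟨?_, ?_⟩, ?_⟩, fun h => (hno _ h o (by simp)).1 rfl⟩
  · intro e he
    rcases Finset.mem_insert.1 he with rfl | he
    · simpa using hou
    · exact h1 e he
  · intro e he f hf v hve hvf
    rcases Finset.mem_insert.1 he with rfl | he <;> rcases Finset.mem_insert.1 hf with rfl | hf
    · rfl
    · have := hno f hf v hvf
      rcases Sym2.mem_iff.1 hve with h | h
      exacts [(this.1 h).elim, (this.2.1 h).elim]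
    · have := hno e he v hve
      rcases Sym2.mem_iff.1 hvf with h | h
      exacts [(this.1 h).elim, (this.2.1 h).elim]
    · exact h2 e he f hf v hve hvf
  · intro e he v hv
    rcases Finset.mem_insert.1 he with rfl | he
    · rcases Sym2.mem_iff.1 hv with rfl | rfl <;> simp [hu]
    · exact Finset.mem_insert_of_mem (hno e he v hv).2.2

theorem erase_edge_mem_configsIn {S : Finset V} {o u : V} {D : Finset (Sym2 V)}
    (hD : D ∈ configsIn G (insert o S)) (hou : s(o, u) ∈ D) :
    D.erase s(o, u) ∈ configsIn G (S.erase u) := by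
  rw [mem_configsIn] at hD
  obtain ⟨⟨h1, h2⟩, h3⟩ := hD
  refine mem_configsIn.2 ⟨⟨fun e he => h1 e (Finset.mem_of_mem_erase he),
    fun e he f hf => h2 e (Finset.mem_of_mem_erase he) f (Finset.mem_of_mem_erase hf)⟩, ?_⟩
  intro e he v hv
  have he' := Finset.mem_erase.1 he
  have hvo : v ≠ o := fun h => he'.1 (h2 e he'.2 _ hou v hv (by simp [h]))
  have hvu : v ≠ u := fun h => he'.1 (h2 e he'.2 _ hou v hv (by simp [h]))
  have := h3 e he'.2 v hv
  simp_all

/-- Expansion of the partition function at a vertex: it is free or matched with a neighbour. -/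
theorem partitionIn_insert [DecidableRel G.Adj] (hx : x ≠ 0) {S : Finset V} {o : V} (ho : o ∉ S) :
    partitionIn G x (insert o S) =
      x * partitionIn G x S + ∑ u ∈ S with G.Adj o u, partitionIn G x (S.erase u) := by
  have hcard : (insert o S).card = S.card + 1 := Finset.card_insert_of_notMem ho
  have hfree : (configsIn G (insert o S)).filter (fun D => ∀ u, s(o, u) ∉ D) = configsIn G S := by
    ext D
    simp only [Finset.mem_filter, mem_configsIn]
    constructor
    · rintro ⟨⟨h1, h3⟩, h⟩
      refine ⟨h1, fun e he v hv => (Finset.mem_insert.1 (h3 e he v hv)).resolve_left ?_⟩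
      rintro rfl
      obtain ⟨w, rfl⟩ := hv
      exact h w he
    · rintro ⟨h1, h3⟩
      exact ⟨⟨h1, fun e he v hv => Finset.mem_insert_of_mem (h3 e he v hv)⟩,
        fun u hu => ho (h3 _ hu o (by simp))⟩
  rw [partitionIn, ← Finset.sum_filter_add_sum_filter_not _ (fun D => ∀ u, s(o, u) ∉ D), hfree]
  congr 1
  · rw [partitionIn, Finset.mul_sum]
    refine Finset.sum_congr rfl fun D _ => ?_
    rw [hcard, ← zpow_one_add₀ hx]
    congr 1
    push_cast
    ring
  · simp only [partitionIn]
    rw [Finset.sum_sigma']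
    symm
    refine Finset.sum_bij (fun p _ => insert s(o, p.1) p.2) ?_ ?_ ?_ ?_
    · rintro ⟨u, D⟩ h
      simp only [Finset.mem_sigma, Finset.mem_filter] at h
      refine Finset.mem_filter.2 ⟨(insert_edge_mem_configsIn ho h.1.1 h.1.2 h.2).1, ?_⟩
      push Not
      exact ⟨u, Finset.mem_insert_self _ _⟩
    · rintro ⟨u, D⟩ h ⟨u', D'⟩ h' heq
      simp only [Finset.mem_sigma, Finset.mem_filter] at h h' heq
      have k := insert_edge_mem_configsIn ho h.1.1 h.1.2 h.2
      have k' := insert_edge_mem_configsIn ho h'.1.1 h'.1.2 h'.2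
      have huu : s(o, u) = s(o, u') := (mem_configsIn.1 k.1).1.2 _ (Finset.mem_insert_self _ _) _
        (heq ▸ Finset.mem_insert_self _ _) o (by simp) (by simp)
      obtain rfl : u = u' := by
        rcases Sym2.eq_iff.1 huu with h | h
        exacts [h.2, (h.2.trans h.1)]
      congr 1
      simpa [Finset.erase_insert k.2, Finset.erase_insert k'.2] using
        congrArg (fun D => Finset.erase D s(o, u)) heq
    · intro D hD
      rw [Finset.mem_filter] at hD
      obtain ⟨hD, h⟩ := hD
      push Not at h
      obtain ⟨u, hu⟩ := h
      have hD' := mem_configsIn.1 hD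
      have hadj : G.Adj o u := hD'.1.1 _ hu
      refine ⟨⟨u, D.erase s(o, u)⟩, ?_, Finset.insert_erase hu⟩
      simp only [Finset.mem_sigma, Finset.mem_filter]
      refine ⟨⟨(Finset.mem_insert.1 (hD'.2 _ hu u (by simp))).resolve_left hadj.ne', hadj⟩,
        erase_edge_mem_configsIn hD hu⟩
    · rintro ⟨u, D⟩ h
      simp only [Finset.mem_sigma, Finset.mem_filter] at h
      have k := insert_edge_mem_configsIn ho h.1.1 h.1.2 h.2
      have h1 : 1 ≤ S.card := Finset.card_pos.2 ⟨u, h.1.1⟩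
      -- The weights agree without a factor of x: (|S| + 1) - 2(|D| + 1) = (|S| - 1) - 2|D|.
      rw [hcard, Finset.card_insert_of_notMem k.2, Finset.card_erase_of_mem h.1.1]
      congr 1
      push_cast [h1]
      ring

/-- The partition function is multiplicative over unions without edges in between. -/
theorem partitionIn_union (hx : x ≠ 0) {S T : Finset V} (hST : Disjoint S T)
    (hadj : ∀ u ∈ S, ∀ v ∈ T, ¬ G.Adj u v) :
    partitionIn G x (S ∪ T) = partitionIn G x S * partitionIn G x T := by
  classical
  -- Strong induction, because the expansion at `o` removes one vertex in the free term and two in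
  -- the matched ones.
  induction hn : S.card using Nat.strong_induction_on generalizing S with
  | _ n ih =>
    rcases S.eq_empty_or_nonempty with rfl | ⟨o, ho⟩
    · simp [partitionIn_empty]
    obtain ⟨S', ho', rfl⟩ : ∃ S', o ∉ S' ∧ insert o S' = S :=
      ⟨S.erase o, Finset.notMem_erase _ _, Finset.insert_erase ho⟩
    have hoT : o ∉ T := Finset.disjoint_left.1 hST ho
    rw [Finset.insert_union, partitionIn_insert hx (by simp [ho', hoT]), partitionIn_insert hx ho']
    rw [Finset.disjoint_insert_left] at hST
    rw [Finset.card_insert_of_notMem ho'] at hn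
    have hS' : ∀ u ∈ S', ∀ v ∈ T, ¬ G.Adj u v := fun u hu => hadj u (Finset.mem_insert_of_mem hu)
    rw [ih _ (by omega) hST.2 hS' rfl]
    have hfil : (S' ∪ T).filter (fun u => G.Adj o u) = S'.filter (fun u => G.Adj o u) := by
      ext u
      have := hadj o ho u
      simp only [Finset.mem_filter, Finset.mem_union]
      tauto
    rw [hfil, add_mul, Finset.sum_mul, mul_assoc]
    congr 1
    refine Finset.sum_congr rfl fun u hu => ?_
    have hu' := (Finset.mem_filter.1 hu).1
    have huT : u ∉ T := Finset.disjoint_left.1 hST.2 hu'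
    rw [Finset.erase_union_distrib, Finset.erase_eq_of_notMem huT]
    exact ih _ (by rw [Finset.card_erase_of_mem hu']; omega)
      (hST.2.mono_left (Finset.erase_subset _ _))
      (fun v hv => hS' v (Finset.mem_of_mem_erase hv)) rfl

/-- The probability of a monomer on `o` in the subgraph of `G` induced by `S`. -/
def monomerProbIn {V : Type*} [Fintype V] [DecidableEq V] (G : SimpleGraph V) (x : ℝ)
    (S : Finset V) (o : V) : ℝ :=
  x * partitionIn G x (S.erase o) / partitionIn G x S

/-- Configurations leaving `o` free are exactly those of the graph without `o`; the factor x is the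
lost monomer. -/
theorem monomerProb_eq_monomerProbIn (hx : x ≠ 0) (o : V) :
    monomerProb x G o = monomerProbIn G x Finset.univ o := by
  classical
  have hfree : (dimericConfigs G).filter (fun D => o ∈ monomers D) =
      configsIn G (Finset.univ.erase o) := by
    ext D
    have hmon : o ∈ monomers D ↔ ∀ u, s(u, o) ∉ D := Iff.rfl
    rw [Finset.mem_filter, mem_configsIn, mem_dimericConfigs, hmon]
    simp only [Finset.mem_erase, Finset.mem_univ, and_true]
    refine and_congr_right fun _ => ⟨?_, fun h u hu => h _ hu o (by simp) rfl⟩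
    rintro h e he v ⟨w, rfl⟩ rfl
    exact h w (by rwa [Sym2.eq_swap])
  rw [monomerProb, bracket, monomerProbIn, partitionIn_univ, partitionIn, ← hfree,
    Finset.sum_filter, Finset.mul_sum, Finset.sum_div]
  refine Finset.sum_congr rfl fun D _ => ?_
  have h1 : 1 ≤ Fintype.card V := Fintype.card_pos_iff.2 ⟨o⟩
  by_cases hD : o ∈ monomers D
  · simp only [Set.indicator, Set.mem_ofPred_eq, hD, if_true, one_mul, gibbs, weight]
    rw [Finset.card_erase_of_mem (Finset.mem_univ o), Finset.card_univ, ← zpow_one_add₀ hx,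
      div_eq_inv_mul]
    congr 2
    push_cast [h1]
    ring
  · simp [Set.indicator, hD]

/-- The expansion at `o` divided by the partition function of `S.erase o`: each matched term becomes
a monomer probability in the graph with `o` removed. -/
theorem monomerProbIn_eq [DecidableRel G.Adj] (hx : 0 < x) {S : Finset V} {o : V} (ho : o ∈ S) :
    monomerProbIn G x S o =
      x ^ 2 / (x ^ 2 + ∑ u ∈ S with G.Adj o u, monomerProbIn G x (S.erase o) u) := by
  have key := partitionIn_insert (G := G) hx.ne' (Finset.notMem_erase o S)
  rw [Finset.insert_erase ho] at key
  have hfil : (S.erase o).filter (fun u => G.Adj o u) = S.filter (fun u => G.Adj o u) := by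
    ext u
    simp only [Finset.mem_filter, Finset.mem_erase]
    exact ⟨fun h => ⟨h.1.2, h.2⟩, fun h => ⟨⟨h.2.ne', h.1⟩, h.2⟩⟩
  simp only [monomerProbIn]
  rw [key, hfil, ← Finset.sum_div, ← Finset.mul_sum]
  have h0 := partitionIn_pos (G := G) hx (S.erase o)
  have h1 : 0 ≤ ∑ u ∈ S with G.Adj o u, partitionIn G x ((S.erase o).erase u) :=
    Finset.sum_nonneg fun u _ => (partitionIn_pos hx _).le
  generalize ∑ u ∈ S with G.Adj o u, partitionIn G x ((S.erase o).erase u) = s at h1 ⊢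
  generalize partitionIn G x (S.erase o) = a at h0 ⊢
  have h2 : 0 < x * a + s := by positivity
  field_simp

theorem monomerProbIn_union (hx : 0 < x) {S T : Finset V} {o : V} (ho : o ∈ S)
    (hST : Disjoint S T) (hadj : ∀ u ∈ S, ∀ v ∈ T, ¬ G.Adj u v) :
    monomerProbIn G x (S ∪ T) o = monomerProbIn G x S o := by
  have hoT : o ∉ T := Finset.disjoint_left.1 hST ho
  rw [monomerProbIn, monomerProbIn, Finset.erase_union_distrib, Finset.erase_eq_of_notMem hoT,
    partitionIn_union hx.ne' hST hadj, partitionIn_union hx.ne'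
      (hST.mono_left (Finset.erase_subset _ _)) fun v hv => hadj v (Finset.mem_of_mem_erase hv)]
  have h0 := partitionIn_pos (G := G) hx T
  have h1 := partitionIn_pos (G := G) hx S
  field_simp

end Matchings

/-! ### The root recursion on truncated trees -/

section TreeRecursion

/-- The recursion `r` generations deep on the tree whose vertices carry the offspring numbers
`(ξ v).1`, started from the values `(ξ v).2` in generation `r`. -/
def treeRec (x : ℝ) : ℕ → (List ℕ → ℕ × ℝ) → ℝ
  | 0, ξ => (ξ []).2
  | r + 1, ξ => recursionMap x ((ξ []).1, fun i => treeRec x r fun w => ξ (i :: w))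

/-- The vertices of the truncated tree that descend from `v`. -/
def descendants {k : List ℕ → ℕ} {r : ℕ} (v : firstGenerations k r) :
    Finset (firstGenerations k r) := by
  classical exact Finset.univ.filter fun w => v.1.1 <+: w.1.1

variable {k : List ℕ → ℕ} {r : ℕ}

theorem mem_descendants {v w : firstGenerations k r} : w ∈ descendants v ↔ v.1.1 <+: w.1.1 := by
  simp [descendants]

theorem truncatedTree_adj {v w : firstGenerations k r} :
    (truncatedTree k r).Adj v w ↔ ∃ i : ℕ, w.1.1 = v.1.1 ++ [i] ∨ v.1.1 = w.1.1 ++ [i] := Iff.rfl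

theorem firstGenerations_ext {v w : firstGenerations k r} (h : v.1.1 = w.1.1) : v = w :=
  Subtype.ext (Subtype.ext h)

theorem append_mem_vertexSet {v : List ℕ} (hv : v ∈ vertexSet k) {i : ℕ} :
    v ++ [i] ∈ vertexSet k ↔ i < k v := by
  refine ⟨fun h => h v i List.prefix_rfl, fun hi u j h => ?_⟩
  rcases List.prefix_concat_iff.1 h with h | h
  · obtain ⟨rfl, h⟩ := List.append_inj' h rfl
    obtain rfl : j = i := by simpa using h
    exact hi
  · exact hv u j h

theorem son_of_adj {v u : firstGenerations k r} (hu : u ∈ descendants v)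
    (h : (truncatedTree k r).Adj v u) : ∃ i : ℕ, u.1.1 = v.1.1 ++ [i] := by
  obtain ⟨i, h | h⟩ := truncatedTree_adj.1 h
  · exact ⟨i, h⟩
  · have := (mem_descendants.1 hu).length_le
    rw [h] at this
    simp at this

/-- The only edge leaving the subtree of `u` upwards ends in `v`. Once `v` is deleted, that subtree
is separated from the rest, which cancels by `monomerProbIn_union`. -/
theorem monomerProbIn_son {x : ℝ} (hx : 0 < x) {v u : firstGenerations k r} {i : ℕ}
    (hu : u.1.1 = v.1.1 ++ [i]) :
    monomerProbIn (truncatedTree k r) x ((descendants v).erase v) u =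
      monomerProbIn (truncatedTree k r) x (descendants u) u := by
  have hvu : v.1.1 <+: u.1.1 := hu ▸ List.prefix_append _ _
  have hsub : descendants u ⊆ (descendants v).erase v := by
    intro w hw
    rw [mem_descendants] at hw
    refine Finset.mem_erase.2 ⟨?_, mem_descendants.2 (hvu.trans hw)⟩
    rintro rfl
    have := hw.length_le
    simp [hu] at this
  rw [← Finset.union_sdiff_of_subset hsub]
  refine monomerProbIn_union hx (mem_descendants.2 List.prefix_rfl) Finset.disjoint_sdiff ?_
  intro a ha b hb hab
  rw [Finset.mem_sdiff, Finset.mem_erase, mem_descendants, mem_descendants] at hb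
  rw [mem_descendants] at ha
  obtain ⟨j, h | h⟩ := truncatedTree_adj.1 hab
  · exact hb.2 (h ▸ ha.trans (List.prefix_append _ _))
  · rw [h] at ha
    rcases List.prefix_concat_iff.1 ha with h' | h'
    · rw [hu] at h'
      exact hb.1.1 (firstGenerations_ext (List.append_inj' h' rfl).1.symm)
    · exact hb.2 h'

/-- Induction on the number `n` of generations below `v`. In generation `r` a vertex has no sons
left, so its probability is x²/x² = 1, the starting value. -/
theorem monomerProbIn_descendants {x : ℝ} (hx : 0 < x) (n : ℕ) (v : firstGenerations k r)
    (hv : v.1.1.length + n = r) :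
    monomerProbIn (truncatedTree k r) x (descendants v) v =
      treeRec x n fun w => (k (v.1.1 ++ w), 1) := by
  classical
  induction n generalizing v with
  | zero =>
    rw [monomerProbIn_eq hx (mem_descendants.2 List.prefix_rfl), Finset.filter_false_of_mem]
    · simp [treeRec, hx.ne']
    · intro u hu h
      obtain ⟨i, hi⟩ := son_of_adj hu h
      have h1 : u.1.1.length ≤ r := u.2
      have h2 := congrArg List.length hi
      simp at h2
      omega
  | succ n ih =>
    rw [monomerProbIn_eq hx (mem_descendants.2 List.prefix_rfl), treeRec, recursionMap]
    congr 2
    symm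
    have hmem : ∀ i, i < k v.1.1 → v.1.1 ++ [i] ∈ vertexSet k := fun i hi =>
      (append_mem_vertexSet v.1.2).2 hi
    have hlen : ∀ i, (v.1.1 ++ [i]).length ≤ r := fun i => by simp; omega
    refine Finset.sum_bij (fun i hi => (⟨⟨v.1.1 ++ [i], hmem i (by simpa using hi)⟩, hlen i⟩ :
      firstGenerations k r)) ?_ ?_ ?_ ?_
    · intro i _
      refine Finset.mem_filter.2 ⟨mem_descendants.2 (List.prefix_append _ _), ?_⟩
      exact truncatedTree_adj.2 ⟨i, Or.inl rfl⟩
    · intro i _ j _ h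
      simpa using congrArg (fun u : firstGenerations k r => u.1.1) h
    · intro u hu
      rw [Finset.mem_filter] at hu
      obtain ⟨i, hi⟩ := son_of_adj hu.1 hu.2
      have : i < k v.1.1 := (append_mem_vertexSet v.1.2).1 (hi ▸ u.1.2)
      exact ⟨i, by simpa using this, firstGenerations_ext hi.symm⟩
    · intro i hi
      have hi' : i < k v.1.1 := by simpa using hi
      let u : firstGenerations k r := ⟨⟨v.1.1 ++ [i], hmem i hi'⟩, hlen i⟩
      have h1 := monomerProbIn_son hx (v := v) (u := u) rfl
      have h2 := ih u (by simp [u]; omega)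
      refine Eq.trans ?_ (h1.trans h2).symm
      simp [u]

/-- On a truncated tree the monomer probability at the root is given by the recursion. -/
theorem monomerProb_truncatedTree {x : ℝ} (hx : 0 < x) (k : List ℕ → ℕ) (r : ℕ) :
    monomerProb x (truncatedTree k r) (root k r) = treeRec x r fun w => (k w, 1) := by
  have huniv : descendants (root k r) = Finset.univ := by
    ext w
    simp [mem_descendants, root]
  rw [monomerProb_eq_monomerProbIn hx.ne', ← huniv,
    monomerProbIn_descendants hx r (root k r) (by simp [root])]
  simp [root]

end TreeRecursion

/-! ### Ultrafilter limits of bounded holomorphic functions and Vitali's theorem -/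

section NormalFamilies

open Metric

/-- A pointwise limit, along an ultrafilter, of uniformly bounded holomorphic functions is
holomorphic. -/
theorem differentiableOn_of_tendsto_ultrafilter {ι : Type*} (U : Ultrafilter ι) {f : ι → ℂ → ℂ}
    {F : ℂ → ℂ} {c : ℂ} {R M : ℝ} (hR : 0 < R)
    (hd : ∀ n, DifferentiableOn ℂ (f n) (closedBall c R))
    (hb : ∀ n, ∀ z ∈ closedBall c R, ‖f n z‖ ≤ M)
    (hF : ∀ z ∈ ball c R, Tendsto (fun n => f n z) U (𝓝 (F z))) :
    DifferentiableOn ℂ F (ball c (R / 2)) := by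
  lift R to NNReal using hR.le
  have hR' : 0 < R := by exact_mod_cast hR
  have hps : ∀ n, HasFPowerSeriesOnBall (f n) (cauchyPowerSeries (f n) c R) c R := fun n =>
    (hd n).hasFPowerSeriesOnBall hR'
  set a : ι → ℕ → ℂ := fun n k => (cauchyPowerSeries (f n) c R).coeff k with ha
  have hab : ∀ n k, ‖a n k‖ ≤ M * (R : ℝ)⁻¹ ^ k := by
    intro n k
    have h1 : ‖a n k‖ ≤ ‖cauchyPowerSeries (f n) c R k‖ := by
      rw [ha, FormalMultilinearSeries.norm_apply_eq_norm_coef]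
    refine h1.trans ((norm_cauchyPowerSeries_le _ _ _ _).trans ?_)
    rw [abs_of_pos hR]
    refine mul_le_mul_of_nonneg_right ?_ (by positivity)
    have h2 : ∫ θ : ℝ in 0..2 * Real.pi, ‖f n (circleMap c R θ)‖ ≤ M * |2 * Real.pi - 0| := by
      refine (le_abs_self _).trans ?_
      rw [← Real.norm_eq_abs]
      refine intervalIntegral.norm_integral_le_of_norm_le_const fun θ _ => ?_
      rw [norm_norm]
      exact hb n _ (circleMap_mem_closedBall _ hR.le _)
    have hpi := Real.pi_pos
    rw [sub_zero, abs_of_pos (by positivity)] at h2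
    rw [inv_mul_le_iff₀ (by positivity)]
    linarith
  have hM : 0 ≤ M := by
    obtain ⟨n⟩ : Nonempty ι := U.neBot.nonempty
    exact (norm_nonneg _).trans (hb n c (mem_closedBall_self hR.le))
  -- Cauchy's estimate keeps each Taylor coefficient in a compact disc, so it converges along the
  -- ultrafilter; no diagonal subsequence is needed.
  have hlim : ∀ k, ∃ b : ℂ, ‖b‖ ≤ M * (R : ℝ)⁻¹ ^ k ∧ Tendsto (fun n => a n k) U (𝓝 b) := by
    intro k
    obtain ⟨b, hb1, hb2⟩ := (isCompact_closedBall (0 : ℂ) (M * (R : ℝ)⁻¹ ^ k)).ultrafilter_le_nhds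
      (U.map fun n => a n k) (by
        rw [le_principal_iff]
        exact Filter.mem_map.2 (Filter.Eventually.of_forall fun n => by simpa using hab n k))
    exact ⟨b, by simpa using hb1, hb2⟩
  choose b hb1 hb2 using hlim
  -- Halving the radius gives a geometric majorant independent of n, for the exchange of limit and
  -- sum.
  have hterm : ∀ z ∈ ball c ((R : ℝ) / 2), ∀ k (t : ℂ), ‖t‖ ≤ M * (R : ℝ)⁻¹ ^ k →
      ‖t * (z - c) ^ k‖ ≤ M * (1 / 2) ^ k := by
    intro z hz k t ht
    rw [mem_ball, dist_eq_norm] at hz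
    rw [norm_mul, norm_pow]
    calc ‖t‖ * ‖z - c‖ ^ k ≤ (M * (R : ℝ)⁻¹ ^ k) * ((R : ℝ) / 2) ^ k := by gcongr
      _ = M * (1 / 2) ^ k := by
        rw [mul_assoc, ← mul_pow]
        congr 2
        field_simp
  have hsum : Summable fun k : ℕ => M * (1 / 2 : ℝ) ^ k :=
    (summable_geometric_of_lt_one (by norm_num) (by norm_num)).mul_left M
  have hFs : ∀ z ∈ ball c ((R : ℝ) / 2), F z = ∑' k, b k * (z - c) ^ k := by
    intro z hz
    have hz' : z ∈ ball c (R : ℝ) := ball_subset_ball (by linarith) hz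
    have h1 : ∀ n, f n z = ∑' k, a n k * (z - c) ^ k := by
      intro n
      have hz2 : z - c ∈ eball (0 : ℂ) R := by
        rw [mem_eball, edist_zero_right]
        rw [mem_ball, dist_eq_norm] at hz'
        rw [← ofReal_norm, ENNReal.ofReal_lt_iff_lt_toReal (norm_nonneg _) (by simp)]
        simpa using hz'
      have := (hps n).hasSum hz2
      simp only [add_sub_cancel] at this
      rw [← this.tsum_eq]
      refine tsum_congr fun k => ?_
      rw [FormalMultilinearSeries.apply_eq_pow_smul_coeff, smul_eq_mul, mul_comm]
    have h2 : Tendsto (fun n => f n z) U (𝓝 (∑' k, b k * (z - c) ^ k)) := by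
      simp_rw [h1]
      exact tendsto_tsum_of_dominated_convergence hsum (fun k => (hb2 k).mul_const _)
        (Filter.Eventually.of_forall fun n k => hterm z hz k _ (hab n k))
    exact tendsto_nhds_unique (hF z hz') h2
  refine DifferentiableOn.congr ?_ hFs
  refine Complex.differentiableOn_tsum_of_summable_norm hsum (fun k => ?_) isOpen_ball
    fun k z hz => hterm z hz k _ (hb1 k)
  fun_prop

/-- The open right half-plane. -/
def rightHalfPlane : Set ℂ := {z | 0 < z.re}

theorem isOpen_rightHalfPlane : IsOpen rightHalfPlane :=
  isOpen_lt continuous_const Complex.continuous_re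

variable {f : ℕ → ℂ → ℂ}

/-- The bound 1/Re z is locally uniform: Re z ≥ Re c / 2 on the disc of radius Re c / 2 about c. -/
theorem analyticOnNhd_of_tendsto_ultrafilter
    (hd : ∀ n, DifferentiableOn ℂ (f n) rightHalfPlane)
    (hb : ∀ n, ∀ z ∈ rightHalfPlane, ‖f n z‖ ≤ z.re⁻¹) (U : Ultrafilter ℕ) {F : ℂ → ℂ}
    (hF : ∀ z ∈ rightHalfPlane, Tendsto (fun n => f n z) U (𝓝 (F z))) :
    AnalyticOnNhd ℂ F rightHalfPlane := by
  refine DifferentiableOn.analyticOnNhd (fun c hc => ?_) isOpen_rightHalfPlane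
  have hc' : 0 < c.re := hc
  have hsub : ∀ z ∈ closedBall c (c.re / 2), c.re / 2 ≤ z.re := by
    intro z hz
    rw [mem_closedBall, dist_eq_norm] at hz
    have := (abs_le.1 ((Complex.abs_re_le_norm (z - c)).trans hz)).1
    rw [Complex.sub_re] at this
    linarith
  have hsub' : closedBall c (c.re / 2) ⊆ rightHalfPlane := fun z hz =>
    lt_of_lt_of_le (by linarith) (hsub z hz)
  have := differentiableOn_of_tendsto_ultrafilter U (f := f) (F := F) (c := c) (R := c.re / 2)
    (M := (c.re / 2)⁻¹) (by linarith) (fun n => (hd n).mono hsub')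
    (fun n z hz => (hb n z (hsub' hz)).trans (inv_anti₀ (by linarith) (hsub z hz)))
    (fun z hz => hF z (hsub' (ball_subset_closedBall hz)))
  exact (this.differentiableAt (ball_mem_nhds c (by linarith))).differentiableWithinAt

theorem exists_tendsto_ultrafilter
    (hb : ∀ n, ∀ z ∈ rightHalfPlane, ‖f n z‖ ≤ z.re⁻¹) (U : Ultrafilter ℕ) :
    ∃ F : ℂ → ℂ, ∀ z ∈ rightHalfPlane, Tendsto (fun n => f n z) U (𝓝 (F z)) := by
  have : ∀ z : ℂ, ∃ w : ℂ, z ∈ rightHalfPlane → Tendsto (fun n => f n z) U (𝓝 w) := by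
    intro z
    by_cases hz : z ∈ rightHalfPlane
    · obtain ⟨w, -, hw⟩ := (isCompact_closedBall (0 : ℂ) z.re⁻¹).ultrafilter_le_nhds
        (U.map fun n => f n z) (by
          rw [le_principal_iff]
          exact Filter.mem_map.2 (Filter.Eventually.of_forall fun n => by simpa using hb n z hz))
      exact ⟨w, fun _ => hw⟩
    · exact ⟨0, fun h => (hz h).elim⟩
  choose F hF using this
  exact ⟨F, fun z hz => hF z hz⟩

/-- Vitali's theorem on the right half-plane: convergence at the points of a sequence with a limit
point implies convergence everywhere. -/
theorem exists_analytic_limit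
    (hd : ∀ n, DifferentiableOn ℂ (f n) rightHalfPlane)
    (hb : ∀ n, ∀ z ∈ rightHalfPlane, ‖f n z‖ ≤ z.re⁻¹)
    {z₀ : ℂ} (hz₀ : z₀ ∈ rightHalfPlane) {u : ℕ → ℂ}
    (hu : Tendsto u atTop (𝓝[≠] z₀)) (hmem : ∀ m, u m ∈ rightHalfPlane)
    (hconv : ∀ m, ∃ l, Tendsto (fun n => f n (u m)) atTop (𝓝 l)) :
    ∃ F : ℂ → ℂ, AnalyticOnNhd ℂ F rightHalfPlane ∧
      ∀ z ∈ rightHalfPlane, Tendsto (fun n => f n z) atTop (𝓝 (F z)) := by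
  have hpre : IsPreconnected rightHalfPlane := (convex_halfSpace_re_gt 0).isPreconnected
  obtain ⟨U₀, hU₀⟩ := Ultrafilter.exists_le (atTop : Filter ℕ)
  obtain ⟨F, hF⟩ := exists_tendsto_ultrafilter hb U₀
  have hFa := analyticOnNhd_of_tendsto_ultrafilter hd hb U₀ hF
  -- Convergence means that all ultrafilters finer than `atTop` give the same limit. Two such limits
  -- are analytic and agree at the points `u m`, hence everywhere by the identity theorem.
  refine ⟨F, hFa, fun z hz => (tendsto_iff_ultrafilter _ _ _).2 fun U hU => ?_⟩
  obtain ⟨F', hF'⟩ := exists_tendsto_ultrafilter hb U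
  have hFa' := analyticOnNhd_of_tendsto_ultrafilter hd hb U hF'
  have heq : EqOn F F' rightHalfPlane := by
    refine hFa.eqOn_of_preconnected_of_frequently_eq hFa' hpre hz₀ ?_
    refine hu.frequently (Filter.Frequently.of_forall fun m => ?_)
    obtain ⟨l, hl⟩ := hconv m
    rw [tendsto_nhds_unique (hF _ (hmem m)) (hl.mono_left hU₀),
      tendsto_nhds_unique (hF' _ (hmem m)) (hl.mono_left hU)]
  rw [heq hz]
  exact hF' z hz

end NormalFamilies

/-! ### Holomorphic extension of the recursion in the activity -/

section ComplexRecursion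

/-- The recursion for the monomer probability divided by the activity, at a complex activity. -/
def complexRec : ℕ → (List ℕ → ℕ) → ℂ → ℂ
  | 0, _, z => z⁻¹
  | r + 1, κ, z => (z + ∑ i ∈ Finset.range (κ []), complexRec r (fun w => κ (i :: w)) z)⁻¹

theorem inv_bounds {z : ℂ} {a : ℝ} (ha : 0 < a) (hz : a ≤ z.re) :
    0 ≤ (z⁻¹).re ∧ ‖z⁻¹‖ ≤ a⁻¹ := by
  refine ⟨?_, ?_⟩
  · rw [Complex.inv_re]
    exact div_nonneg (by linarith) (Complex.normSq_nonneg _)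
  · rw [norm_inv]
    exact inv_anti₀ ha (hz.trans (Complex.re_le_norm z))

/-- Inversion preserves the right half-plane. The sons' values thus only increase the real part of
the denominator, which stays at least Re z at every depth. -/
theorem complexRec_bounds (r : ℕ) (κ : List ℕ → ℕ) {z : ℂ} (hz : z ∈ rightHalfPlane) :
    0 ≤ (complexRec r κ z).re ∧ ‖complexRec r κ z‖ ≤ z.re⁻¹ := by
  induction r generalizing κ with
  | zero => exact inv_bounds hz le_rfl
  | succ r ih =>
    refine inv_bounds hz ?_
    rw [Complex.add_re, Complex.re_sum]
    exact le_add_of_nonneg_right (Finset.sum_nonneg fun i _ => (ih _).1)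

theorem differentiableOn_complexRec (r : ℕ) (κ : List ℕ → ℕ) :
    DifferentiableOn ℂ (complexRec r κ) rightHalfPlane := by
  induction r generalizing κ with
  | zero =>
    intro z hz
    have : z ≠ 0 := by rintro rfl; simp [rightHalfPlane] at hz
    exact (differentiableAt_inv this).differentiableWithinAt
  | succ r ih =>
    refine DifferentiableOn.inv (differentiableOn_id.add
      (DifferentiableOn.fun_sum fun i _ => ih _)) fun z hz h => ?_
    have h1 := congrArg Complex.re h
    change (z + ∑ i ∈ Finset.range (κ []), complexRec r (fun w => κ (i :: w)) z).re = 0 at h1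
    rw [Complex.add_re, Complex.re_sum] at h1
    have h2 : 0 ≤ ∑ i ∈ Finset.range (κ []), (complexRec r (fun w => κ (i :: w)) z).re :=
      Finset.sum_nonneg fun i _ => (complexRec_bounds r _ hz).1
    have h3 : 0 < z.re := hz
    linarith

theorem treeRec_eq_complexRec {x : ℝ} (hx : x ≠ 0) (r : ℕ) (κ : List ℕ → ℕ) :
    (treeRec x r (fun w => (κ w, 1)) : ℂ) = x * complexRec r κ x := by
  have hx' : (x : ℂ) ≠ 0 := by exact_mod_cast hx
  induction r generalizing κ with
  | zero => simp [treeRec, complexRec, hx']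
  | succ r ih =>
    simp only [treeRec, recursionMap, complexRec]
    push_cast
    simp only [ih]
    rw [← Finset.mul_sum, sq, ← mul_add, mul_div_mul_left _ _ hx', div_eq_mul_inv]

/-- If the recursion converges at the activities `c + 1 / (m + 1)`, then it converges at all
positive activities. -/
theorem exists_tendsto_treeRec {c : ℝ} (hc : 0 < c) {κ : List ℕ → ℕ}
    (h : ∀ m : ℕ, ∃ l, Tendsto (fun r => treeRec (c + 1 / ((m : ℝ) + 1)) r fun w => (κ w, 1))
      atTop (𝓝 l)) {x : ℝ} (hx : 0 < x) :
    ∃ l, Tendsto (fun r => treeRec x r fun w => (κ w, 1)) atTop (𝓝 l) := by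
  have hpos : ∀ m : ℕ, 0 < c + 1 / ((m : ℝ) + 1) := fun m => by positivity
  obtain ⟨F, -, hF⟩ := exists_analytic_limit (f := fun r => complexRec r κ) (z₀ := (c : ℂ))
    (fun r => differentiableOn_complexRec r κ) (fun r z hz => (complexRec_bounds r κ hz).2)
    (by simpa [rightHalfPlane] using hc) (u := fun m : ℕ => ((c + 1 / ((m : ℝ) + 1) : ℝ) : ℂ))
    (by
      refine tendsto_nhdsWithin_iff.2 ⟨?_, Filter.Eventually.of_forall fun m h => ?_⟩
      · refine (Complex.continuous_ofReal.tendsto c).comp ?_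
        simpa using tendsto_one_div_add_atTop_nhds_zero_nat.const_add c
      · have h1 : c + 1 / ((m : ℝ) + 1) = c := Complex.ofReal_injective h
        have h2 : 0 < 1 / ((m : ℝ) + 1) := by positivity
        linarith)
    (fun m => by simpa only [rightHalfPlane, Set.mem_ofPred_eq, Complex.ofReal_re] using hpos m)
    (fun m => by
      obtain ⟨l, hl⟩ := h m
      refine ⟨((c + 1 / ((m : ℝ) + 1) : ℝ) : ℂ)⁻¹ * (l : ℂ), ?_⟩
      have := ((Complex.continuous_ofReal.tendsto l).comp hl).const_mul
        ((c + 1 / ((m : ℝ) + 1) : ℝ) : ℂ)⁻¹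
      refine this.congr fun r => ?_
      have hne : ((c + 1 / ((m : ℝ) + 1) : ℝ) : ℂ) ≠ 0 := by exact_mod_cast (hpos m).ne'
      rw [Function.comp, treeRec_eq_complexRec (hpos m).ne', inv_mul_cancel_left₀ hne])
  refine ⟨((x : ℂ) * F x).re, ?_⟩
  have h1 := (Complex.continuous_re.tendsto _).comp
    ((hF x (by simpa [rightHalfPlane] using hx)).const_mul (x : ℂ))
  refine h1.congr fun r => ?_
  simp only [Function.comp]
  rw [← treeRec_eq_complexRec hx.ne', Complex.ofReal_re]

/-- A pointwise limit of the recursion is real analytic in the activity. -/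
theorem analyticOnNhd_of_tendsto_treeRec {κ : List ℕ → ℕ} {Y : ℝ → ℝ}
    (h : ∀ x, 0 < x → Tendsto (fun r => treeRec x r fun w => (κ w, 1)) atTop (𝓝 (Y x))) :
    AnalyticOnNhd ℝ Y (Ioi 0) := by
  obtain ⟨U, hU⟩ := Ultrafilter.exists_le (atTop : Filter ℕ)
  have hd := fun r => differentiableOn_complexRec r κ
  have hb := fun r z (hz : z ∈ rightHalfPlane) => (complexRec_bounds r κ hz).2
  obtain ⟨F, hF⟩ := exists_tendsto_ultrafilter hb U
  have hFa := analyticOnNhd_of_tendsto_ultrafilter hd hb U hF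
  have hmem : ∀ x : ℝ, 0 < x → (x : ℂ) ∈ rightHalfPlane := fun x hx => by
    simpa [rightHalfPlane] using hx
  have heq : EqOn (fun x : ℝ => x * (F x).re) Y (Ioi 0) := by
    intro x hx
    have h1 := (Complex.continuous_re.tendsto _).comp ((hF x (hmem x hx)).const_mul (x : ℂ))
    have h2 : ((x : ℂ) * F x).re = Y x := by
      refine tendsto_nhds_unique h1 (((h x hx).mono_left hU).congr fun r => ?_)
      simp only [Function.comp]
      rw [← treeRec_eq_complexRec (ne_of_gt hx), Complex.ofReal_re]
    rw [← h2, Complex.re_ofReal_mul]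
  refine AnalyticOnNhd.congr (isOpen_Ioi) (fun x hx => ?_) heq
  refine analyticAt_id.mul ?_
  have h1 : AnalyticAt ℝ F (x : ℂ) := (hFa x (hmem x hx)).restrictScalars
  have h2 : AnalyticAt ℝ (fun y : ℝ => F (Complex.ofRealCLM y)) x :=
    AnalyticAt.fun_comp (g := F) (f := fun y : ℝ => Complex.ofRealCLM y) (by simpa using h1)
      (Complex.ofRealCLM.analyticAt x)
  exact (Complex.reCLM.analyticAt _).comp h2

end ComplexRecursion

/-! ### The branching property of trees with independent marks -/

section Branching

open Measure

variable {E : Type*} [MeasurableSpace E]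

/-- A marked tree, cut into the mark of its root and the subtrees at the sons of the root. -/
def splitRoot (ξ : List ℕ → E) : E × (ℕ → List ℕ → E) := (ξ [], fun i w => ξ (i :: w))

theorem measurable_splitRoot : Measurable (splitRoot : (List ℕ → E) → E × (ℕ → List ℕ → E)) := by
  unfold splitRoot
  fun_prop

/-- The marked tree with given root mark and given other marks. -/
def joinRoot (p : E × (ℕ × List ℕ → E)) : List ℕ → E
  | [] => p.1
  | i :: w => p.2 (i, w)

theorem measurable_joinRoot : Measurable (joinRoot : E × (ℕ × List ℕ → E) → List ℕ → E) := by
  refine measurable_pi_iff.2 fun v => ?_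
  cases v with
  | nil => exact measurable_fst
  | cons i w => exact (measurable_pi_apply (i, w)).comp measurable_snd

theorem map_joinRoot (m : List ℕ → Measure E) [∀ v, IsProbabilityMeasure (m v)] :
    ((m []).prod (infinitePi fun p : ℕ × List ℕ => m (p.1 :: p.2))).map joinRoot =
      infinitePi m := by
  classical
  refine eq_infinitePi _ fun s t ht => ?_
  let c : ℕ × List ℕ → List ℕ := fun p => p.1 :: p.2
  have hc : Function.Injective c := fun p q h => by
    have := List.cons.inj h
    exact Prod.ext this.1 this.2
  have hpre : joinRoot ⁻¹' (Set.pi s t) =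
      (if [] ∈ s then t [] else univ) ×ˢ
        Set.pi (s.preimage c hc.injOn : Finset (ℕ × List ℕ)) (fun p => t (c p)) := by
    ext ⟨a, η⟩
    simp only [Set.mem_preimage, Set.mem_pi, Set.mem_prod, Finset.mem_coe, Finset.mem_preimage]
    constructor
    · intro h
      refine ⟨?_, fun p hp => h _ hp⟩
      split_ifs with h0
      · exact h _ h0
      · trivial
    · rintro ⟨h0, h1⟩ v hv
      cases v with
      | nil => rw [if_pos hv] at h0; exact h0
      | cons i w => exact h1 (i, w) hv
  rw [map_apply measurable_joinRoot (.pi s.countable_toSet fun v _ => ht v), hpre, prod_prod,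
    infinitePi_pi _ fun p _ => ht _]
  -- The nonempty words are the range of `c`; the empty word contributes the remaining factor, or 1
  -- if it is not in `s`.
  rw [Finset.prod_preimage' c s hc.injOn fun v => m v (t v),
    ← Finset.prod_filter_mul_prod_filter_not s (fun v => v ∈ Set.range c), mul_comm]
  congr 1
  have hr : ∀ v, v ∉ Set.range c ↔ v = [] := by
    intro v
    cases v with
    | nil => simp [c]
    | cons i w => simp [c]
  simp only [hr]
  rw [Finset.prod_filter, Finset.prod_ite_eq']
  split_ifs <;> simp

/-- Splitting undoes joining up to currying the marks off the root, and currying turns a product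
measure into an iterated one. -/
theorem map_splitRoot (m : List ℕ → Measure E) [∀ v, IsProbabilityMeasure (m v)] :
    (infinitePi m).map splitRoot =
      (m []).prod (infinitePi fun i => infinitePi fun w => m (i :: w)) := by
  rw [← map_joinRoot m, map_map measurable_splitRoot measurable_joinRoot]
  have hcomp : splitRoot ∘ joinRoot =
      Prod.map (id : E → E) (MeasurableEquiv.curry ℕ (List ℕ) E) := by
    ext p <;> rfl
  rw [hcomp, ← map_prod_map _ _ measurable_id (MeasurableEquiv.measurable _), Measure.map_id]
  congr 1
  exact infinitePi_map_curry (fun i w => m (i :: w))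

/-- The law of a tree of independent marks: `m₀` is the law of the mark of the root, and `m` is the
law of all other marks. -/
def markedTree (m₀ m : Measure E) : Measure (List ℕ → E) :=
  infinitePi fun v => if v = [] then m₀ else m

theorem markedTree_self (m : Measure E) : markedTree m m = infinitePi fun _ => m := by
  simp [markedTree]

variable (m₀ m : Measure E) [IsProbabilityMeasure m₀] [IsProbabilityMeasure m]

instance (v : List ℕ) : IsProbabilityMeasure (if v = [] then m₀ else m) := by
  split_ifs <;> infer_instance

instance : IsProbabilityMeasure (markedTree m₀ m) := by
  unfold markedTree; infer_instance

theorem map_splitRoot_markedTree : (markedTree m₀ m).map splitRoot =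
    m₀.prod (infinitePi fun _ => markedTree m m) := by
  rw [markedTree, map_splitRoot]
  simp [markedTree]

/-- The functionals of the subtrees at the sons of the root are i.i.d., and independent of the mark
of the root. -/
theorem map_root_subtrees {F : (List ℕ → E) → ℝ} (hF : Measurable F) :
    (markedTree m₀ m).map (fun ξ => (ξ [], fun i => F fun w => ξ (i :: w))) =
      m₀.prod (infinitePi fun _ : ℕ => (markedTree m m).map F) := by
  have h : (fun ξ : List ℕ → E => (ξ [], fun i => F fun w => ξ (i :: w))) =
      Prod.map id (fun (η : ℕ → List ℕ → E) i => F (η i)) ∘ splitRoot := rfl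
  have hF' : Measurable fun (η : ℕ → List ℕ → E) i => F (η i) := by fun_prop
  rw [h, ← map_map (measurable_id.prodMap hF') measurable_splitRoot, map_splitRoot_markedTree,
    ← map_prod_map _ _ measurable_id hF', Measure.map_id, infinitePi_map_pi _ fun _ => hF]

/-- The subtree at label `i` never sees the root mark. Marks sit on all words, so `i` need not be an
actual son. -/
theorem ae_subtrees {p : (List ℕ → E) → Prop} (hp : ∀ᵐ ξ ∂markedTree m m, p ξ) :
    ∀ᵐ ξ ∂markedTree m₀ m, ∀ i, p fun w => ξ (i :: w) := by
  refine ae_all_iff.2 fun i => ?_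
  have h : (markedTree m₀ m).map (fun ξ w => ξ (i :: w)) = markedTree m m := by
    have h1 : (fun (ξ : List ℕ → E) w => ξ (i :: w)) =
      (fun η : ℕ → List ℕ → E => η i) ∘ Prod.snd ∘ splitRoot := rfl
    rw [h1, ← map_map (measurable_pi_apply i) (measurable_snd.comp measurable_splitRoot),
      ← map_map measurable_snd measurable_splitRoot, map_splitRoot_markedTree, Measure.map_snd_prod]
    simp [infinitePi_map_eval]
  rw [← h] at hp
  exact ae_of_ae_map (measurable_pi_iff.2 fun w => measurable_pi_apply (i :: w)).aemeasurable hp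

end Branching

/-! ### Monotonicity and Lipschitz bounds for the recursion -/

section Bounds

variable {x : ℝ}

theorem recursionMap_mem_Icc {n : ℕ} {y : ℕ → ℝ} (hy : ∀ i, 0 ≤ y i) :
    recursionMap x (n, y) ∈ Icc (0 : ℝ) 1 := by
  have h : 0 ≤ ∑ i ∈ Finset.range n, y i := Finset.sum_nonneg fun i _ => hy i
  exact ⟨div_nonneg (sq_nonneg x) (by positivity),
    div_le_one_of_le₀ (by simpa using h) (by positivity)⟩

theorem recursionMap_antitone (hx : 0 < x) {n : ℕ} {y y' : ℕ → ℝ} (hy : ∀ i, 0 ≤ y i)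
    (hyy : ∀ i, y i ≤ y' i) : recursionMap x (n, y') ≤ recursionMap x (n, y) := by
  have h : 0 ≤ ∑ i ∈ Finset.range n, y i := Finset.sum_nonneg fun i _ => hy i
  have h' : ∑ i ∈ Finset.range n, y i ≤ ∑ i ∈ Finset.range n, y' i :=
    Finset.sum_le_sum fun i _ => hyy i
  exact div_le_div_of_nonneg_left (sq_nonneg x) (by positivity) (by simpa using h')

/-- The slope of s ↦ x²/(x² + s) on s ≥ 0 is at most x⁻² in absolute value. This is the source of
the contraction for large x. -/
theorem abs_recursionMap_sub_le (hx : 0 < x) {n : ℕ} {y y' : ℕ → ℝ} (hy : ∀ i, 0 ≤ y i)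
    (hy' : ∀ i, 0 ≤ y' i) : |recursionMap x (n, y) - recursionMap x (n, y')| ≤
      (x ^ 2)⁻¹ * ∑ i ∈ Finset.range n, |y i - y' i| := by
  have h : 0 ≤ ∑ i ∈ Finset.range n, y i := Finset.sum_nonneg fun i _ => hy i
  have h' : 0 ≤ ∑ i ∈ Finset.range n, y' i := Finset.sum_nonneg fun i _ => hy' i
  have hd : |∑ i ∈ Finset.range n, y' i - ∑ i ∈ Finset.range n, y i| ≤
      ∑ i ∈ Finset.range n, |y i - y' i| := by
    rw [← Finset.sum_sub_distrib]
    refine (Finset.abs_sum_le_sum_abs _ _).trans_eq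
      (Finset.sum_congr rfl fun i _ => abs_sub_comm _ _)
  simp only [recursionMap]
  generalize ∑ i ∈ Finset.range n, y i = s at h hd ⊢
  generalize ∑ i ∈ Finset.range n, y' i = s' at h' hd ⊢
  have hx2 : 0 < x ^ 2 := by positivity
  have heq : x ^ 2 / (x ^ 2 + s) - x ^ 2 / (x ^ 2 + s') =
      x ^ 2 / ((x ^ 2 + s) * (x ^ 2 + s')) * (s' - s) := by
    have : x ^ 2 + s ≠ 0 := by positivity
    have : x ^ 2 + s' ≠ 0 := by positivity
    field_simp
    ring
  rw [heq, abs_mul, abs_of_nonneg (by positivity)]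
  refine mul_le_mul ?_ hd (abs_nonneg _) (by positivity)
  rw [div_le_iff₀ (by positivity), ← div_eq_inv_mul, le_div_iff₀ hx2]
  nlinarith

theorem tendsto_recursionMap (hx : 0 < x) {n : ℕ} {y : ℕ → ℕ → ℝ} {l : ℕ → ℝ}
    (hy : ∀ i r, 0 ≤ y i r) (h : ∀ i, Tendsto (y i) atTop (𝓝 (l i))) :
    Tendsto (fun r => recursionMap x (n, fun i => y i r)) atTop (𝓝 (recursionMap x (n, l))) := by
  have hl : ∀ i, 0 ≤ l i := fun i => ge_of_tendsto' (h i) (hy i)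
  have hs : 0 ≤ ∑ i ∈ Finset.range n, l i := Finset.sum_nonneg fun i _ => hl i
  exact tendsto_const_nhds.div ((tendsto_finsetSum _ fun i _ => h i).const_add (x ^ 2))
    (by positivity)

theorem treeRec_mem_Icc (r : ℕ) {ξ : List ℕ → ℕ × ℝ} (hξ : ∀ v, (ξ v).2 ∈ Icc (0 : ℝ) 1) :
    treeRec x r ξ ∈ Icc (0 : ℝ) 1 := by
  induction r generalizing ξ with
  | zero => exact hξ []
  | succ r ih => exact recursionMap_mem_Icc fun i => (ih fun w => hξ (i :: w)).1

theorem measurable_treeRec (x : ℝ) (r : ℕ) : Measurable (treeRec x r) := by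
  induction r with
  | zero => exact measurable_snd.comp (measurable_pi_apply _)
  | succ r ih =>
    refine (measurable_recursionMap x).comp (Measurable.prodMk
      (measurable_fst.comp (measurable_pi_apply _)) (measurable_pi_iff.2 fun i => ih.comp ?_))
    exact measurable_pi_iff.2 fun w => measurable_pi_apply (i :: w)

/-- The monomer probability at the root of the tree with offspring numbers `κ`, cut after `r`
generations. -/
def rootProb (x : ℝ) (r : ℕ) (κ : List ℕ → ℕ) : ℝ := treeRec x r fun w => (κ w, 1)

theorem rootProb_succ (x : ℝ) (r : ℕ) (κ : List ℕ → ℕ) :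
    rootProb x (r + 1) κ = recursionMap x (κ [], fun i => rootProb x r fun w => κ (i :: w)) := rfl

theorem rootProb_mem_Icc (x : ℝ) (r : ℕ) (κ : List ℕ → ℕ) : rootProb x r κ ∈ Icc (0 : ℝ) 1 :=
  treeRec_mem_Icc r fun _ => ⟨zero_le_one, le_rfl⟩

theorem measurable_rootProb (x : ℝ) (r : ℕ) : Measurable (rootProb x r) := by
  refine (measurable_treeRec x r).comp (measurable_pi_iff.2 fun w => ?_)
  exact (measurable_pi_apply w).prodMk measurable_const

/-- The recursion started from values in `[0, 1]` lies between the recursions started from the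
extreme values. -/
theorem treeRec_between (hx : 0 < x) (r : ℕ) :
    (∀ ξ : List ℕ → ℕ × ℝ, (∀ v, (ξ v).2 ∈ Icc (0 : ℝ) 1) →
      treeRec x (r + 1) ξ ∈ Icc (rootProb x r fun v => (ξ v).1)
        (rootProb x (r + 1) fun v => (ξ v).1)) ∨
    (∀ ξ : List ℕ → ℕ × ℝ, (∀ v, (ξ v).2 ∈ Icc (0 : ℝ) 1) →
      treeRec x (r + 1) ξ ∈ Icc (rootProb x (r + 1) fun v => (ξ v).1)
        (rootProb x r fun v => (ξ v).1)) := by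
  induction r with
  | zero =>
    -- The upper bound is `rootProb x 0`, which equals 1. The antitone map then swaps the two
    -- alternatives at each step, so they encode the parity of `r`.
    refine Or.inr fun ξ hξ => ⟨?_, (treeRec_mem_Icc _ hξ).2⟩
    exact recursionMap_antitone hx (fun i => (hξ [i]).1) fun i => (hξ [i]).2
  | succ r ih =>
    rcases ih with ih | ih
    · refine Or.inr fun ξ hξ => ?_
      have h := fun i : ℕ => ih (fun w => ξ (i :: w)) fun w => hξ (i :: w)
      exact ⟨recursionMap_antitone hx (fun i => (treeRec_mem_Icc _ fun w => hξ (i :: w)).1)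
          fun i => (h i).2,
        recursionMap_antitone hx (fun i => (rootProb_mem_Icc _ _ _).1) fun i => (h i).1⟩
    · refine Or.inl fun ξ hξ => ?_
      have h := fun i : ℕ => ih (fun w => ξ (i :: w)) fun w => hξ (i :: w)
      exact ⟨recursionMap_antitone hx (fun i => (treeRec_mem_Icc _ fun w => hξ (i :: w)).1)
          fun i => (h i).2,
        recursionMap_antitone hx (fun i => (rootProb_mem_Icc _ _ _).1) fun i => (h i).1⟩

theorem tendsto_treeRec (hx : 0 < x) {ξ : List ℕ → ℕ × ℝ} (hξ : ∀ v, (ξ v).2 ∈ Icc (0 : ℝ) 1)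
    {l : ℝ} (h : Tendsto (fun r => rootProb x r fun v => (ξ v).1) atTop (𝓝 l)) :
    Tendsto (fun r => treeRec x (r + 1) ξ) atTop (𝓝 l) := by
  have h' := h.comp (tendsto_add_atTop_nat 1)
  refine tendsto_of_tendsto_of_tendsto_of_le_of_le (by simpa using h.min h')
    (by simpa using h.max h') (fun r => ?_) fun r => ?_
  · rcases treeRec_between hx r with k | k
    · exact (min_le_left _ _).trans (k ξ hξ).1
    · exact (min_le_right _ _).trans (k ξ hξ).1
  · rcases treeRec_between hx r with k | k
    · exact (k ξ hξ).2.trans (le_max_right _ _)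
    · exact (k ξ hξ).2.trans (le_max_left _ _)

end Bounds

/-! ### Almost sure convergence at all positive activities -/

section Convergence

/-- Convergence of the monomer probability at the root at all positive activities. -/
def Converges (κ : List ℕ → ℕ) : Prop :=
  ∀ x, 0 < x → ∃ l, Tendsto (fun r => rootProb x r κ) atTop (𝓝 l)

/-- The limit of the monomer probability at the root. -/
def rootLimit (x : ℝ) (κ : List ℕ → ℕ) : ℝ := limsup (fun r => rootProb x r κ) atTop

/-- Taking a limsup makes the limit measurable on the whole space, including where convergence
fails. -/
theorem measurable_rootLimit (x : ℝ) : Measurable (rootLimit x) :=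
  Measurable.limsup fun r => measurable_rootProb x r

theorem Converges.tendsto {κ : List ℕ → ℕ} (h : Converges κ) {x : ℝ} (hx : 0 < x) :
    Tendsto (fun r => rootProb x r κ) atTop (𝓝 (rootLimit x κ)) := by
  obtain ⟨l, hl⟩ := h x hx
  rwa [rootLimit, hl.limsup_eq]

theorem tendsto_of_subtrees {κ : List ℕ → ℕ} (h : ∀ i : ℕ, Converges fun w => κ (i :: w)) {x : ℝ}
    (hx : 0 < x) : Tendsto (fun r => rootProb x r κ) atTop
      (𝓝 (recursionMap x (κ [], fun i => rootLimit x fun w => κ (i :: w)))) := by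
  rw [← tendsto_add_atTop_iff_nat 1]
  exact tendsto_recursionMap hx (y := fun i r => rootProb x r fun w => κ (i :: w))
    (fun i r => (rootProb_mem_Icc _ _ _).1) fun i => (h i).tendsto hx

theorem converges_of_subtrees {κ : List ℕ → ℕ} (h : ∀ i : ℕ, Converges fun w => κ (i :: w)) :
    Converges κ := fun _ hx => ⟨_, tendsto_of_subtrees h hx⟩

theorem rootLimit_eq {κ : List ℕ → ℕ} (h : ∀ i : ℕ, Converges fun w => κ (i :: w)) {x : ℝ}
    (hx : 0 < x) :
    rootLimit x κ = recursionMap x (κ [], fun i => rootLimit x fun w => κ (i :: w)) :=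
  (tendsto_of_subtrees h hx).limsup_eq

theorem rootLimit_mem_Icc {κ : List ℕ → ℕ} (h : Converges κ) {x : ℝ} (hx : 0 < x) :
    rootLimit x κ ∈ Icc (0 : ℝ) 1 :=
  isClosed_Icc.mem_of_tendsto (h.tendsto hx)
    (Filter.Eventually.of_forall fun r => rootProb_mem_Icc x r κ)

/-- The expected distance between successive monomer probabilities at the root. -/
def meanStep (ρ : PMF ℕ) (x : ℝ) (r : ℕ) : ℝ≥0∞ :=
  ∫⁻ κ, edist (rootProb x r κ) (rootProb x (r + 1) κ) ∂markedTree ρ.toMeasure ρ.toMeasure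

variable {ρ : PMF ℕ}

/-- The Lipschitz bound gives a sum over the sons, whose number is independent of their identically
distributed subtrees; hence the mean of ρ as a factor. -/
theorem meanStep_succ_le {x : ℝ} (hx : 0 < x) (r : ℕ) :
    meanStep ρ x (r + 1) ≤
      ENNReal.ofReal (x ^ 2)⁻¹ * (∑' n : ℕ, (n : ℝ≥0∞) * ρ n) * meanStep ρ x r := by
  have hmeas : ∀ r, Measurable (rootProb x r) := measurable_rootProb x
  set d : (List ℕ → ℕ) → ℝ≥0∞ := fun κ => edist (rootProb x r κ) (rootProb x (r + 1) κ)
  have hdm : Measurable d := (hmeas r).edist (hmeas (r + 1))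
  let g : ℕ × (ℕ → List ℕ → ℕ) → ℝ≥0∞ := fun p => ∑ i ∈ Finset.range p.1, d (p.2 i)
  have hgm : Measurable g := measurable_from_prod_countable_right fun n =>
    Finset.measurable_fun_sum (Finset.range n) (f := fun i (η : ℕ → List ℕ → ℕ) => d (η i))
      fun i _ => hdm.comp (measurable_pi_apply i)
  have hpt : ∀ κ, edist (rootProb x (r + 1) κ) (rootProb x (r + 2) κ) ≤
      ENNReal.ofReal (x ^ 2)⁻¹ * g (splitRoot κ) := by
    intro κ
    rw [edist_dist, Real.dist_eq, rootProb_succ, rootProb_succ x (r + 1)]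
    refine (ENNReal.ofReal_le_ofReal (abs_recursionMap_sub_le hx
      (fun i => (rootProb_mem_Icc _ _ _).1) fun i => (rootProb_mem_Icc _ _ _).1)).trans_eq ?_
    rw [ENNReal.ofReal_mul (by positivity), ENNReal.ofReal_sum_of_nonneg fun i _ => abs_nonneg _]
    simp only [g, d, splitRoot, edist_dist, Real.dist_eq]
  have hint : ∫⁻ κ, g (splitRoot κ) ∂markedTree ρ.toMeasure ρ.toMeasure =
      (∑' n : ℕ, (n : ℝ≥0∞) * ρ n) * meanStep ρ x r := by
    rw [← lintegral_map hgm measurable_splitRoot, map_splitRoot_markedTree,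
      lintegral_prod _ hgm.aemeasurable]
    have hin : ∀ n : ℕ, ∫⁻ η : ℕ → List ℕ → ℕ, g (n, η)
        ∂(Measure.infinitePi fun _ => markedTree ρ.toMeasure ρ.toMeasure) =
          n * meanStep ρ x r := by
      intro n
      simp only [g]
      rw [lintegral_finsetSum (f := fun i (η : ℕ → List ℕ → ℕ) => d (η i)) _
        fun i _ => hdm.comp (measurable_pi_apply i)]
      have : ∀ i : ℕ, ∫⁻ η : ℕ → List ℕ → ℕ, d (η i)
          ∂(Measure.infinitePi fun _ => markedTree ρ.toMeasure ρ.toMeasure) = meanStep ρ x r :=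
        fun i => (measurePreserving_eval_infinitePi
          (fun _ : ℕ => markedTree ρ.toMeasure ρ.toMeasure) i).lintegral_comp hdm
      simp [this]
    simp_rw [hin]
    rw [lintegral_mul_const _ (by fun_prop), lintegral_countable']
    simp [PMF.toMeasure_apply_singleton]
  calc meanStep ρ x (r + 1) ≤ ∫⁻ κ, ENNReal.ofReal (x ^ 2)⁻¹ * g (splitRoot κ)
        ∂markedTree ρ.toMeasure ρ.toMeasure := lintegral_mono hpt
    _ = _ := by
      rw [lintegral_const_mul (f := fun κ => g (splitRoot κ)) _ (hgm.comp measurable_splitRoot),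
        hint, mul_assoc]

theorem ae_exists_tendsto_of_large {x : ℝ} (hx : 0 < x)
    (h : ∑' n : ℕ, (n : ℝ≥0∞) * ρ n < ENNReal.ofReal (x ^ 2)) :
    ∀ᵐ κ ∂markedTree ρ.toMeasure ρ.toMeasure,
      ∃ l, Tendsto (fun r => rootProb x r κ) atTop (𝓝 l) := by
  set q := ENNReal.ofReal (x ^ 2)⁻¹ * (∑' n : ℕ, (n : ℝ≥0∞) * ρ n) with hq
  have hx2 : 0 < x ^ 2 := by positivity
  have hq1 : q < 1 := by
    rw [hq, ENNReal.ofReal_inv_of_pos hx2, mul_comm, ← div_eq_mul_inv]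
    exact ENNReal.div_lt_of_lt_mul (by simpa using h)
  have hstep : ∀ r, meanStep ρ x r ≤ q ^ r * meanStep ρ x 0 := by
    intro r
    induction r with
    | zero => simp
    | succ r ih =>
      refine (meanStep_succ_le hx r).trans ?_
      rw [pow_succ' q, mul_assoc q, ← hq]
      exact mul_le_mul_right ih q
  have h0 : meanStep ρ x 0 ≤ 1 := by
    refine (lintegral_mono (g := fun _ => 1) fun κ => ?_).trans_eq (by simp)
    rw [edist_dist, Real.dist_eq]
    have h1 := rootProb_mem_Icc x 0 κ
    have h2 := rootProb_mem_Icc x (0 + 1) κ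
    refine ENNReal.ofReal_le_one.2 (abs_le.2 ⟨?_, ?_⟩) <;> linarith [h1.1, h1.2, h2.1, h2.2]
  have hmeas : ∀ r, Measurable fun κ => edist (rootProb x r κ) (rootProb x (r + 1) κ) := fun r =>
    (measurable_rootProb x r).edist (measurable_rootProb x (r + 1))
  have hsum : ∫⁻ κ, ∑' r, edist (rootProb x r κ) (rootProb x (r + 1) κ)
      ∂markedTree ρ.toMeasure ρ.toMeasure ≠ ∞ := by
    rw [lintegral_tsum fun r => (hmeas r).aemeasurable]
    refine ne_top_of_le_ne_top ?_ (ENNReal.tsum_le_tsum fun r => (hstep r).trans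
      (mul_le_of_le_one_right' h0))
    rw [ENNReal.tsum_geometric]
    exact ENNReal.inv_ne_top.2 (tsub_pos_of_lt hq1).ne'
  filter_upwards [ae_lt_top (Measurable.tsum hmeas) hsum] with κ hκ
  exact cauchySeq_tendsto_of_complete
    (cauchySeq_of_edist_le_of_tsum_ne_top _ (fun r => le_rfl) hκ.ne)

theorem ae_converges_self (hρ : ∑' n : ℕ, (n : ℝ≥0∞) * ρ n < ∞) :
    ∀ᵐ κ ∂markedTree ρ.toMeasure ρ.toMeasure, Converges κ := by
  set a := (∑' n : ℕ, (n : ℝ≥0∞) * ρ n).toReal with ha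
  -- The activities a + 1 + 1/(m + 1) have squares above a, so the contraction applies, and they
  -- accumulate at a + 1 > 0, as Vitali's theorem requires.
  have ha0 : 0 ≤ a := ENNReal.toReal_nonneg
  have hlarge : ∀ m : ℕ, ∀ᵐ κ ∂markedTree ρ.toMeasure ρ.toMeasure,
      ∃ l, Tendsto (fun r => rootProb (a + 1 + 1 / ((m : ℝ) + 1)) r κ) atTop (𝓝 l) := by
    intro m
    have hm : 0 < 1 / ((m : ℝ) + 1) := by positivity
    refine ae_exists_tendsto_of_large (by positivity) ?_
    rw [← ENNReal.ofReal_toReal hρ.ne, ← ha, ENNReal.ofReal_lt_ofReal_iff (by positivity)]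
    nlinarith
  filter_upwards [ae_all_iff.2 hlarge] with κ hκ x hx
  exact exists_tendsto_treeRec (by positivity) hκ hx

theorem ae_subtrees_converge (P : PMF ℕ) (hρ : ∑' n : ℕ, (n : ℝ≥0∞) * ρ n < ∞) :
    ∀ᵐ κ ∂markedTree P.toMeasure ρ.toMeasure, ∀ i : ℕ, Converges fun w => κ (i :: w) :=
  ae_subtrees _ _ (ae_converges_self hρ)

end Convergence

/-! ### The law of the limit and uniqueness of the fixed point -/

section Laws

variable {ρ : PMF ℕ} {x : ℝ}

/-- The law of the limit of the monomer probability at the root of a Galton-Watson tree with the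
same offspring distribution everywhere. -/
def limitLaw (ρ : PMF ℕ) (x : ℝ) : ProbabilityMeasure ℝ :=
  ⟨(markedTree ρ.toMeasure ρ.toMeasure).map (rootLimit x),
    Measure.isProbabilityMeasure_map (measurable_rootLimit x).aemeasurable⟩

/-- The recursion passes to the limit almost surely, and its inputs are i.i.d. by the branching
property. The case `P = ρ` is the fixed point equation. -/
theorem map_rootLimit (P : PMF ℕ) (hρ : ∑' n : ℕ, (n : ℝ≥0∞) * ρ n < ∞) (hx : 0 < x) :
    (markedTree P.toMeasure ρ.toMeasure).map (rootLimit x) = recursionLaw P x (limitLaw ρ x) := by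
  have h : rootLimit x =ᵐ[markedTree P.toMeasure ρ.toMeasure] recursionMap x ∘
      fun κ => (κ [], fun i => rootLimit x fun w => κ (i :: w)) := by
    filter_upwards [ae_subtrees_converge P hρ] with κ hκ
    exact rootLimit_eq hκ hx
  have hm : Measurable fun κ : List ℕ → ℕ =>
      (κ [], fun i : ℕ => rootLimit x fun w => κ (i :: w)) := by
    refine (measurable_pi_apply _).prodMk (measurable_pi_iff.2 fun i => ?_)
    exact (measurable_rootLimit x).comp (measurable_pi_iff.2 fun w => measurable_pi_apply (i :: w))
  rw [Measure.map_congr h, ← Measure.map_map (measurable_recursionMap x) hm,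
    map_root_subtrees _ _ (measurable_rootLimit x)]
  rfl

theorem isFixedPointLaw_limitLaw (hρ : ∑' n : ℕ, (n : ℝ≥0∞) * ρ n < ∞) (hx : 0 < x) :
    IsFixedPointLaw ρ x (limitLaw ρ x) := by
  refine ⟨?_, Subtype.ext (map_rootLimit ρ hρ hx).symm⟩
  refine (ae_map_iff (measurable_rootLimit x).aemeasurable measurableSet_Icc).2 ?_
  filter_upwards [ae_converges_self hρ] with κ hκ
  exact rootLimit_mem_Icc hκ hx

/-- The recursion started from independent values with a fixed point law keeps that law. -/
theorem map_treeRec {ν : ProbabilityMeasure ℝ} (hν : recursionLaw ρ x ν = ν) (r : ℕ) :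
    (markedTree (ρ.toMeasure.prod (ν : Measure ℝ)) (ρ.toMeasure.prod (ν : Measure ℝ))).map
      (treeRec x r) = ν := by
  set m := ρ.toMeasure.prod (ν : Measure ℝ) with hm
  induction r with
  | zero =>
    have h : treeRec x 0 = Prod.snd ∘ fun ξ : List ℕ → ℕ × ℝ => ξ [] := rfl
    rw [h, ← Measure.map_map measurable_snd (measurable_pi_apply _), markedTree_self,
      Measure.infinitePi_map_eval, hm, Measure.map_snd_prod]
    simp
  | succ r ih =>
    have h : treeRec x (r + 1) = recursionMap x ∘ Prod.map Prod.fst id ∘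
        fun ξ : List ℕ → ℕ × ℝ => (ξ [], fun i : ℕ => treeRec x r fun w => ξ (i :: w)) := rfl
    have hmeas : Measurable fun ξ : List ℕ → ℕ × ℝ =>
        (ξ [], fun i : ℕ => treeRec x r fun w => ξ (i :: w)) := by
      refine (measurable_pi_apply _).prodMk (measurable_pi_iff.2 fun i => ?_)
      exact (measurable_treeRec x r).comp
        (measurable_pi_iff.2 fun w => measurable_pi_apply (i :: w))
    have hp : Measurable (Prod.map Prod.fst id : (ℕ × ℝ) × (ℕ → ℝ) → ℕ × (ℕ → ℝ)) :=
      measurable_fst.prodMap measurable_id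
    rw [h, ← Measure.map_map (measurable_recursionMap x) (hp.comp hmeas),
      ← Measure.map_map hp hmeas, map_root_subtrees _ _ (measurable_treeRec x r), ih,
      ← Measure.map_prod_map _ _ measurable_fst measurable_id, Measure.map_id, hm,
      Measure.map_fst_prod]
    simp only [measure_univ, one_smul]
    exact congrArg Subtype.val hν

/-- Each vertex gets an independent mark of law `ν`. Starting from the marks in generation r + 1,
the recursion has law `ν` for every r, yet converges almost surely to the limit on the unmarked
tree. -/
theorem eq_limitLaw (hρ : ∑' n : ℕ, (n : ℝ≥0∞) * ρ n < ∞) (hx : 0 < x)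
    {ν : ProbabilityMeasure ℝ} (hν : IsFixedPointLaw ρ x ν) : ν = limitLaw ρ x := by
  set m := ρ.toMeasure.prod (ν : Measure ℝ) with hm
  have hfm : Measurable fun (ξ : List ℕ → ℕ × ℝ) v => (ξ v).1 :=
    measurable_pi_iff.2 fun v => measurable_fst.comp (measurable_pi_apply v)
  have hfst : (markedTree m m).map (fun ξ v => (ξ v).1) =
      markedTree ρ.toMeasure ρ.toMeasure := by
    rw [markedTree_self, markedTree_self, Measure.infinitePi_map_pi _ fun _ => measurable_fst, hm,
      Measure.map_fst_prod]
    simp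
  have hconv : ∀ᵐ ξ ∂markedTree m m, Converges fun v => (ξ v).1 := by
    have := ae_converges_self hρ
    rw [← hfst] at this
    exact ae_of_ae_map hfm.aemeasurable this
  have hmark : ∀ᵐ ξ ∂markedTree m m, ∀ v, (ξ v).2 ∈ Icc (0 : ℝ) 1 := by
    refine ae_all_iff.2 fun v => ?_
    have hv : (markedTree m m).map (fun ξ : List ℕ → ℕ × ℝ => (ξ v).2) = ν := by
      have : (fun ξ : List ℕ → ℕ × ℝ => (ξ v).2) = Prod.snd ∘ fun ξ => ξ v := rfl
      rw [this, ← Measure.map_map measurable_snd (measurable_pi_apply _), markedTree_self,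
        Measure.infinitePi_map_eval, hm, Measure.map_snd_prod]
      simp
    have h1 := hν.1
    rw [← hv] at h1
    exact ae_of_ae_map (measurable_snd.comp (measurable_pi_apply v)).aemeasurable h1
  have hlim : ∀ᵐ ξ ∂markedTree m m, Tendsto (fun r => treeRec x (r + 1) ξ) atTop
      (𝓝 (rootLimit x fun v => (ξ v).1)) := by
    filter_upwards [hconv, hmark] with ξ h1 h2
    exact tendsto_treeRec hx h2 (h1.tendsto hx)
  have hlaw : (markedTree m m).map (fun ξ => rootLimit x fun v => (ξ v).1) = limitLaw ρ x := by
    have : (fun ξ : List ℕ → ℕ × ℝ => rootLimit x fun v => (ξ v).1) =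
      rootLimit x ∘ fun ξ v => (ξ v).1 := rfl
    rw [this, ← Measure.map_map (measurable_rootLimit x) hfm, hfst]
    rfl
  suffices h : (ν : Measure ℝ) = (limitLaw ρ x : Measure ℝ) from Subtype.ext h
  -- For bounded continuous test functions, the integrals are constant in r and converge by
  -- domination to the integral against the limit law.
  refine ext_of_forall_integral_eq_of_IsFiniteMeasure fun f => ?_
  have hconst : ∀ r, ∫ ξ, f (treeRec x (r + 1) ξ) ∂markedTree m m = ∫ y, f y ∂(ν : Measure ℝ) := by
    intro r
    rw [← map_treeRec hν.2 (r + 1), integral_map (measurable_treeRec x _).aemeasurable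
      f.continuous.aestronglyMeasurable]
  have hend : ∫ ξ, f (rootLimit x fun v => (ξ v).1) ∂markedTree m m =
      ∫ y, f y ∂(limitLaw ρ x : Measure ℝ) := by
    rw [← hlaw, integral_map (φ := fun ξ : List ℕ → ℕ × ℝ => rootLimit x fun v => (ξ v).1)
      ((measurable_rootLimit x).comp hfm).aemeasurable f.continuous.aestronglyMeasurable]
  rw [← hend]
  refine tendsto_nhds_unique (f := fun r => ∫ ξ, f (treeRec x (r + 1) ξ) ∂markedTree m m)
    (l := atTop) (by simp only [hconst]; exact tendsto_const_nhds) ?_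
  refine tendsto_integral_of_dominated_convergence (fun _ => ‖f‖)
    (fun r => (f.continuous.measurable.comp (measurable_treeRec x _)).aestronglyMeasurable)
    (integrable_const _) (fun r => Filter.Eventually.of_forall fun ξ => f.norm_coe_le_norm _) ?_
  filter_upwards [hlim] with ξ hξ
  exact (f.continuous.tendsto _).comp hξ

/-- The family of offspring numbers of a Galton-Watson tree is a tree of independent marks. -/
theorem IsGaltonWatson.map_eq {Ω : Type*} [MeasurableSpace Ω] {P ρ : PMF ℕ} {μ : Measure Ω}
    {K : List ℕ → Ω → ℕ} (hK : IsGaltonWatson P ρ μ K) :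
    μ.map (fun ω v => K v ω) = markedTree P.toMeasure ρ.toMeasure := by
  rw [hK.indep.map_fun_eq_infinitePi_map hK.measurable, markedTree]
  congr 1
  ext1 v
  split_ifs with hv
  · rw [hv, hK.law_root]
  · exact hK.law_of_ne_root v hv

end Laws

end MonomerDimer

end

/-! ### Transfer to the given probability space -/

theorem mainTheorem10 {Ω : Type*} [MeasurableSpace Ω] (μ : Measure Ω) [IsProbabilityMeasure μ]
    (P ρ : PMF ℕ) (hρ : ∑' n : ℕ, (n : ℝ≥0∞) * ρ n < ∞)
    (K : List ℕ → Ω → ℕ) (hK : MonomerDimer.IsGaltonWatson P ρ μ K) :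
    ∃ Y : ℝ → Ω → ℝ,
      (∀ᵐ ω ∂μ, ∀ x : ℝ, 0 < x →
        Tendsto (fun r : ℕ => MonomerDimer.monomerProb x
            (MonomerDimer.truncatedTree (fun v => K v ω) r)
            (MonomerDimer.root (fun v => K v ω) r))
          atTop (𝓝 (Y x ω))) ∧
      (∀ᵐ ω ∂μ, AnalyticOnNhd ℝ (fun x => Y x ω) (Ioi 0)) ∧
      ∀ x : ℝ, 0 < x →
        ∃ ν : ProbabilityMeasure ℝ,
          MonomerDimer.IsFixedPointLaw ρ x ν ∧
          (∀ ν' : ProbabilityMeasure ℝ, MonomerDimer.IsFixedPointLaw ρ x ν' → ν' = ν) ∧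
          HasLaw (Y x) (MonomerDimer.recursionLaw P x ν : Measure ℝ) μ := by
  have hmeas : Measurable fun ω v => K v ω := measurable_pi_iff.2 hK.measurable
  have hconv : ∀ᵐ ω ∂μ, MonomerDimer.Converges fun v => K v ω := by
    have h := MonomerDimer.ae_subtrees_converge P hρ
    rw [← hK.map_eq] at h
    filter_upwards [ae_of_ae_map hmeas.aemeasurable h] with ω hω
    exact MonomerDimer.converges_of_subtrees hω
  refine ⟨fun x ω => MonomerDimer.rootLimit x fun v => K v ω, ?_, ?_, fun x hx =>
    ⟨MonomerDimer.limitLaw ρ x, MonomerDimer.isFixedPointLaw_limitLaw hρ hx,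
      fun ν' hν' => MonomerDimer.eq_limitLaw hρ hx hν', ?_, ?_⟩⟩
  · filter_upwards [hconv] with ω hω x hx
    refine (hω.tendsto hx).congr fun r => ?_
    rw [MonomerDimer.monomerProb_truncatedTree hx]
    rfl
  · filter_upwards [hconv] with ω hω
    exact MonomerDimer.analyticOnNhd_of_tendsto_treeRec fun x hx => hω.tendsto hx
  · exact ((MonomerDimer.measurable_rootLimit x).comp hmeas).aemeasurable
  · rw [← MonomerDimer.map_rootLimit P hρ hx, ← hK.map_eq,
      Measure.map_map (MonomerDimer.measurable_rootLimit x) hmeas]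
    rfl
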